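/- Let $B_3=\langle \sigma_1,\sigma_2 : \sigma_1\sigma_2\sigma_1=\sigma_2\sigma_1\sigma_2\rangle$ be the braid group on three strands and let $\Delta=\sigma_1\sigma_2\sigma_1$ be its Garside element. A positive half-twist in $B_3$ is a conjugate of $\sigma_1$, and a power of a positive half-twist is an element $h^e$ with $h$ a positive half-twist and $e\geq 1$ an integer. A factorization of $\Delta^2$ into powers of positive half-twists is a tuple $(g_1,\dots,g_k)$ of powers of positive half-twists with $g_1g_2\cdots g_k=\Delta^2$; it is of type $(e_1,\dots,e_k)$ if $g_j$ is the $e_j$th power of a positive half-twist for each $j$. Then a factorization of $\Delta^2$ into powers of positive half-twists cannot have precisely three factors, where one factor is the cube of a positive half-twist. In particular, there is no factorization of $\Delta^2$ of type $(3,2,1)$, nor of any type obtained from $(3,2,1)$ by reordering. -/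

import Mathlib

namespace BraidThree

/-- The defining relation `σ₁ σ₂ σ₁ = σ₂ σ₁ σ₂` of the Artin presentation of the braid group on
three strands; the generators `σ₁`, `σ₂` are indexed by `0`, `1`. -/
def artinRels : Set (FreeGroup (Fin 2)) :=
  {FreeGroup.of 0 * FreeGroup.of 1 * FreeGroup.of 0 *
    (FreeGroup.of 1 * FreeGroup.of 0 * FreeGroup.of 1)⁻¹}

/-- The braid group `B₃ = ⟨σ₁, σ₂ : σ₁ σ₂ σ₁ = σ₂ σ₁ σ₂⟩`. -/
abbrev B3 : Type := PresentedGroup artinRels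

/-- The Artin generator `σ₁`. -/
def sigma1 : B3 := PresentedGroup.of 0

/-- The Artin generator `σ₂`. -/
def sigma2 : B3 := PresentedGroup.of 1

/-- The Garside element `Δ = σ₁ σ₂ σ₁`. -/
def garside : B3 := sigma1 * sigma2 * sigma1

/-- The positive half-twists in `B₃`: the conjugates of `σ₁`. -/
def IsPositiveHalfTwist (g : B3) : Prop := IsConj sigma1 g

/-- `g` is the `e`th power of a positive half-twist, where `e` is a positive integer. -/
def IsHalfTwistPower (e : ℕ) (g : B3) : Prop :=
  1 ≤ e ∧ ∃ h : B3, IsPositiveHalfTwist h ∧ g = h ^ e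

/-- The tuple `F = (g₁, …, g_k)` is a factorization of `g` into powers of positive half-twists. -/
def IsHalfTwistFactorization (F : List B3) (g : B3) : Prop :=
  (∀ x ∈ F, ∃ e : ℕ, IsHalfTwistPower e x) ∧ F.prod = g

/-- The tuple `F = (g₁, …, g_k)` is a factorization of `g` of type `(e₁, …, e_k)`: each `g_j` is
the `e_j`th power of a positive half-twist. -/
def IsFactorizationOfType (e : List ℕ) (F : List B3) (g : B3) : Prop :=
  List.Forall₂ IsHalfTwistPower e F ∧ F.prod = g

end BraidThree

namespace BraidThree

open Matrix

/-! Map `B3` to `SL₂(𝔽₃)` by `modThree`. Half-twists go to elements with cube `1`, so a cubed factor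
disappears, while `Δ²` goes to `-1`. Three factors would thus leave `x * y = -1` with `x ^ 3 = y ^ 3
= 1`, which `mul_ne_neg_one_of_pow_three_eq_one` excludes. -/

/-- The image of `σ₁` in `SL₂(𝔽₃)`. -/
def modThreeSigma1 : SpecialLinearGroup (Fin 2) (ZMod 3) :=
  ⟨!![1, 1; 0, 1], by simp [Matrix.det_fin_two]⟩

/-- The image of `σ₂` in `SL₂(𝔽₃)`. -/
def modThreeSigma2 : SpecialLinearGroup (Fin 2) (ZMod 3) :=
  ⟨!![1, 0; -1, 1], by simp [Matrix.det_fin_two]⟩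

theorem modThreeSigma1_pow_three : modThreeSigma1 ^ 3 = 1 := by
  apply Subtype.ext
  decide

theorem modThree_braid_relation :
    modThreeSigma1 * modThreeSigma2 * modThreeSigma1 =
      modThreeSigma2 * modThreeSigma1 * modThreeSigma2 := by
  apply Subtype.ext
  decide

theorem modThree_garside_sq :
    (modThreeSigma1 * modThreeSigma2 * modThreeSigma1) ^ 2 = -1 := by
  apply Subtype.ext
  decide

theorem neg_one_ne_one_modThree : (-1 : SpecialLinearGroup (Fin 2) (ZMod 3)) ≠ 1 := by
  intro h
  have h00 := congrArg (fun A : SpecialLinearGroup (Fin 2) (ZMod 3) => A.1 0 0) h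
  revert h00
  decide

/-- The reduction modulo `3` of the representation of `B₃` on the homology of a once-punctured
torus. -/
def modThree : B3 →* SpecialLinearGroup (Fin 2) (ZMod 3) :=
  PresentedGroup.toGroup (f := ![modThreeSigma1, modThreeSigma2]) (by
    rintro r rfl
    rw [map_mul, map_inv, mul_inv_eq_one]
    simpa using modThree_braid_relation)

theorem modThree_sigma1 : modThree sigma1 = modThreeSigma1 := by
  simp [modThree, sigma1]

theorem modThree_sigma2 : modThree sigma2 = modThreeSigma2 := by
  simp [modThree, sigma2]

theorem modThree_garside_pow_two : modThree (garside ^ 2) = -1 := by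
  simp only [garside, map_pow, map_mul, modThree_sigma1, modThree_sigma2, modThree_garside_sq]

theorem IsPositiveHalfTwist.modThree_pow_three {h : B3} (hh : IsPositiveHalfTwist h) :
    modThree h ^ 3 = 1 := by
  obtain ⟨c, rfl⟩ := isConj_iff.1 hh
  simp only [map_mul, map_inv, modThree_sigma1, conj_pow, modThreeSigma1_pow_three, mul_one,
    mul_inv_cancel]

theorem IsHalfTwistPower.modThree_pow_three {e : ℕ} {g : B3} (hg : IsHalfTwistPower e g) :
    modThree g ^ 3 = 1 := by
  obtain ⟨-, h, hh, rfl⟩ := hg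
  rw [map_pow, pow_right_comm, hh.modThree_pow_three, one_pow]

theorem IsHalfTwistPower.modThree_eq_one {g : B3} (hg : IsHalfTwistPower 3 g) :
    modThree g = 1 := by
  obtain ⟨-, h, hh, rfl⟩ := hg
  rw [map_pow, hh.modThree_pow_three]

/-- As `x = -y⁻¹` and 3 is odd, cubing gives `1 = -1`, false in characteristic 3. -/
theorem mul_ne_neg_one_of_pow_three_eq_one {x y : SpecialLinearGroup (Fin 2) (ZMod 3)}
    (hx : x ^ 3 = 1) (hy : y ^ 3 = 1) : x * y ≠ -1 := by
  intro h
  have hxy : x = -y⁻¹ := by rw [eq_mul_inv_of_mul_eq h, neg_mul, one_mul]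
  apply neg_one_ne_one_modThree
  rwa [hxy, Odd.neg_pow (by decide), inv_pow, hy, inv_one] at hx

theorem IsHalfTwistFactorization.not_length_three_of_cube {F : List B3}
    (hF : IsHalfTwistFactorization F (garside ^ 2)) :
    ¬ (F.length = 3 ∧ ∃ g ∈ F, IsHalfTwistPower 3 g) := by
  rintro ⟨hlen, g, hgF, hg⟩
  obtain ⟨a, b, c, rfl⟩ := List.length_eq_three.1 hlen
  obtain ⟨hpow, hprod⟩ := hF
  have hcube : ∀ x ∈ [a, b, c], modThree x ^ 3 = 1 := fun x hx =>
    (hpow x hx).elim fun _ h => h.modThree_pow_three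
  have ha := hcube a (by simp)
  have hb := hcube b (by simp)
  have hc := hcube c (by simp)
  have himage : modThree a * modThree b * modThree c = -1 := by
    rw [← modThree_garside_pow_two, ← hprod]
    simp [mul_assoc]
  have hone := hg.modThree_eq_one
  simp only [List.mem_cons, List.not_mem_nil, or_false] at hgF
  -- Wherever the cube stands, its trivial image drops out and the other two remain in order.
  rcases hgF with rfl | rfl | rfl
  · rw [hone, one_mul] at himage
    exact mul_ne_neg_one_of_pow_three_eq_one hb hc himage
  · rw [hone, mul_one] at himage
    exact mul_ne_neg_one_of_pow_three_eq_one ha hc himage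
  · rw [hone, mul_one] at himage
    exact mul_ne_neg_one_of_pow_three_eq_one ha hb himage

theorem IsFactorizationOfType.isHalfTwistFactorization {e : List ℕ} {F : List B3} {g : B3}
    (h : IsFactorizationOfType e F g) : IsHalfTwistFactorization F g := by
  refine ⟨fun x hx => ?_, h.2⟩
  obtain ⟨i, hi, rfl⟩ := List.mem_iff_getElem.1 hx
  exact ⟨_, h.1.get (h.1.length_eq ▸ hi) hi⟩

theorem IsFactorizationOfType.exists_isHalfTwistPower {e : List ℕ} {F : List B3} {g : B3}
    (h : IsFactorizationOfType e F g) {n : ℕ} (hn : n ∈ e) : ∃ x ∈ F, IsHalfTwistPower n x := by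
  obtain ⟨i, hi, rfl⟩ := List.mem_iff_getElem.1 hn
  have hi' : i < F.length := h.1.length_eq ▸ hi
  exact ⟨F[i], List.getElem_mem hi', h.1.get hi hi'⟩

end BraidThree

theorem mainTheorem10 :
    (∀ F : List BraidThree.B3,
      BraidThree.IsHalfTwistFactorization F (BraidThree.garside ^ 2) →
        ¬ (F.length = 3 ∧ ∃ g ∈ F, BraidThree.IsHalfTwistPower 3 g)) ∧
    (∀ (e : List ℕ) (F : List BraidThree.B3), e.Perm [3, 2, 1] →
      ¬ BraidThree.IsFactorizationOfType e F (BraidThree.garside ^ 2)) := by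
  refine ⟨fun F hF => hF.not_length_three_of_cube, fun e F he hF => ?_⟩
  -- Only the length 3 and the presence of an exponent 3 matter, and both survive reordering.
  exact hF.isHalfTwistFactorization.not_length_three_of_cube
    ⟨hF.1.length_eq.symm.trans he.length_eq,
      hF.exists_isHalfTwistPower (he.mem_iff.2 (by simp))⟩
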